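/- **Definitions.** A literal is a variable $v$ (written $v^1$) or its negation $\neg v$ (written $v^0$). A term is a conjunction of finitely many literals and a DNF is a disjunction of finitely many terms; both are regarded as finite sets, and the empty DNF is the empty clause. For a natural number $s$, the system $\mathrm{Res}(s)$ has the following rules, where $\mathcal D,\mathcal D_1,\mathcal D_2$ are DNFs and $J,J_1,J_2$ are finite sets of literals: 1. from $\mathcal D_1\vee\bigwedge J_1$ and $\mathcal D_2\vee\bigwedge J_2$ infer $\mathcal D_1\vee\mathcal D_2\vee\bigwedge (J_1\cup J_2)$, provided $|J_1\cup J_2|\le s$; 2. from $\mathcal D_1\vee\bigvee_{l\in J} l$ and $\mathcal D_2\vee\bigwedge_{l\in J}\neg l$ infer $\mathcal D_1\vee\mathcal D_2$; 3. from $\mathcal D$ infer $\mathcal D\vee\bigwedge J$, provided $|J|\le s$; and from $\mathcal D\vee\bigwedge(J_1\cup J_2)$ infer $\mathcal D\vee\bigwedge J_1$. A $\mathrm{Res}(s)$ refutation of a set of clauses is a derivation (a directed acyclic graph) of the empty clause from these clauses by the rules; its size is the number of applications of rules (so initial clauses are not counted). Let $n=2^k$ and $m>n$. The formula $\mathrm{Bin\text{-}PHP}^m_n$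 has variables $\omega_{i,\ell}$ for $i\in[m]$ and $\ell\in[\log_2 n]$, and its clauses are $$\bigvee_{\ell=1}^{\log_2 n}\omega_{i,\ell}^{1-a_\ell}\ \vee\ \bigvee_{\ell=1}^{\log_2 n}\omega_{j,\ell}^{1-a_\ell}$$ for all $i\ne j$ in $[m]$ and all holes $a$, where $a_1\dots a_{\log_2 n}$ is the binary representation of $a$ and $a$ ranges over the $n$ holes $0,\dots,n-1$. **Theorem.** For all real $\lambda,\mu>0$ there are a constant $c>0$ and an $n_0$, depending only on $\lambda$ and $\mu$, such that for every $n\ge n_0$ that is a power of $2$, every $m>n$, and every natural number $s\le\sqrt2\,(\log_2 n)^{\frac12-\lambda}$, every $\mathrm{Res}(s)$ refutation of $\mathrm{Bin\text{-}PHP}^m_n$ has size at least $2^{c\,n^{1-\mu}}$. -/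

import Mathlib

/-- A literal over the variables `V`: `(v, true)` is `v¹ = v` and `(v, false)` is `v⁰ = ¬ v`. -/
abbrev Literal (V : Type) := V × Bool

/-- The complementary literal. -/
def Literal.neg {V : Type} (l : Literal V) : Literal V := (l.1, !l.2)

/-- A term: the conjunction of a finite set of literals. The empty term is the constant true. -/
abbrev Term (V : Type) := Finset (Literal V)

/-- A DNF: the disjunction of a finite set of terms. The empty DNF is the empty clause, that is,
the constant false. -/
abbrev DNF (V : Type) := Finset (Term V)

/-- The disjunction of the literals in `J`, as a DNF all of whose terms are single literals. -/
def clauseOf {V : Type} [DecidableEq V] (J : Finset (Literal V)) : DNF V :=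
  J.image (fun l => {l})

/-- `ResStep s A D`: the DNF `D` is obtained by one application of a derivation rule of `Res(s)`
to premises from the set `A`. -/
inductive ResStep {V : Type} [DecidableEq V] (s : ℕ) (A : Set (DNF V)) : DNF V → Prop
  /-- Conjunction introduction:
  from `D₁ ∨ ⋀ J₁` and `D₂ ∨ ⋀ J₂` infer `D₁ ∨ D₂ ∨ ⋀ (J₁ ∪ J₂)` if `|J₁ ∪ J₂| ≤ s`. -/
  | andIntro (D₁ D₂ : DNF V) (J₁ J₂ : Finset (Literal V))
      (h₁ : D₁ ∪ {J₁} ∈ A) (h₂ : D₂ ∪ {J₂} ∈ A) (hs : (J₁ ∪ J₂).card ≤ s) :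
      ResStep s A (D₁ ∪ D₂ ∪ {J₁ ∪ J₂})
  /-- Cut: from `D₁ ∨ ⋁_{l ∈ J} l` and `D₂ ∨ ⋀_{l ∈ J} ¬ l` infer `D₁ ∨ D₂`. -/
  | cut (D₁ D₂ : DNF V) (J : Finset (Literal V))
      (h₁ : D₁ ∪ clauseOf J ∈ A) (h₂ : D₂ ∪ {J.image Literal.neg} ∈ A) :
      ResStep s A (D₁ ∪ D₂)
  /-- First weakening rule: from `D` infer `D ∨ ⋀ J` if `|J| ≤ s`. -/
  | weaken (D : DNF V) (J : Finset (Literal V)) (h : D ∈ A) (hs : J.card ≤ s) :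
      ResStep s A (D ∪ {J})
  /-- Second weakening rule: from `D ∨ ⋀ (J₁ ∪ J₂)` infer `D ∨ ⋀ J₁`. -/
  | shrink (D : DNF V) (J₁ J₂ : Finset (Literal V)) (h : D ∪ {J₁ ∪ J₂} ∈ A) :
      ResStep s A (D ∪ {J₁})

/-- A `Res(s)` refutation of the set `F` of initial DNFs: the proof DAG, its internal nodes listed
in a topological order and labelled by `line`. The sources of the DAG are the elements of `F`,
every internal node follows by one rule from sources and earlier internal nodes, and the empty
clause is reached. The size is the number of internal nodes, that is, the number of applications
of a derivation rule; initial DNFs are not counted. -/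
structure ResRefutation {V : Type} [DecidableEq V] (s : ℕ) (F : Set (DNF V)) where
  size : ℕ
  line : Fin size → DNF V
  derived : ∀ i : Fin size, ResStep s (F ∪ {D | ∃ j : Fin size, j < i ∧ line j = D}) (line i)
  refutes : ∅ ∈ F ∪ Set.range line

/-- The binary representation of the hole `a` among `2 ^ k` holes as a string of `k` bits, from the
most significant to the least significant bit. -/
def bin {k : ℕ} (a : Fin (2 ^ k)) (l : Fin k) : Bool := Nat.testBit a.val (k - 1 - l.val)

/-- The literals `ω_{i,l} ^ (1 - a_l)`, for all bit positions `l`; their disjunction says that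
pigeon `i` does not go to hole `a`. -/
def avoidHole {m k : ℕ} (i : Fin m) (a : Fin (2 ^ k)) : Finset (Literal (Fin m × Fin k)) :=
  Finset.univ.image (fun l : Fin k => ((i, l), !(bin a l)))

/-- The binary encoding of the pigeonhole principle with `m` pigeons and `n = 2 ^ k` holes, in the
variables `ω_{i,l}` for pigeons `i` and bit positions `l`: for all pigeons `i ≠ j` and every
hole `a`, the clause `⋁_l ω_{i,l} ^ (1 - a_l) ∨ ⋁_l ω_{j,l} ^ (1 - a_l)`. -/
def BinPHP (m k : ℕ) : Set (DNF (Fin m × Fin k)) :=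
  {C | ∃ (i j : Fin m) (a : Fin (2 ^ k)), i ≠ j ∧ C = clauseOf (avoidHole i a ∪ avoidHole j a)}

/-! A random restriction fixes at most `s` bits of every pigeon, so each pigeon keeps at least `2 ^
(k - s)` holes. A satisfiable nonempty term of at most `s` literals becomes true with probability at
least `(2k)⁻ˢ`, and terms without common pigeons behave independently. So a DNF either has many
pigeon-disjoint terms, and almost surely becomes true, or all its terms meet a small set of pigeons.
Querying that set removes a literal from every live term, and iterating gives the switching lemma
`unifProb_not_decided_le`: a shallow tree of pigeon queries fails to decide the DNF with probability
at most `2⁻ᵉ`.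

In a refutation with fewer than `2 ^ e` lines, a union bound yields one restriction under which all
lines have shallow trees. This is impossible (`exists_not_decided`). A legal placement of few
pigeons falsifying a conclusion can be extended along the trees of both premises; soundness makes
one premise false, and the pigeons on its own branch suffice to falsify it (`Refutable.of_sound`).
Thus falsity would travel from the empty clause back to an initial clause, which no legal placement
falsifies.

The trees have height below `e * growth k s ^ s`. With the given bound on `s`, the loss `growth k s
^ s * 2 ^ s` is `n ^ o(1)`, which leaves room for `e` about `n ^ (1 - μ)`. -/

/-! ### Uniform probability on a finite type -/

open scoped Classical in
/-- The probability of `A` under the uniform distribution on `Ω`. -/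
noncomputable def unifProb {Ω : Type*} [Fintype Ω] (A : Ω → Prop) : ℝ :=
  ((Finset.univ.filter A).card : ℝ) / Fintype.card Ω

section UnifProb

variable {Ω : Type*} [Fintype Ω]

theorem unifProb_eq (A : Ω → Prop) [DecidablePred A] :
    unifProb A = ((Finset.univ.filter A).card : ℝ) / Fintype.card Ω := by
  unfold unifProb
  congr!

theorem unifProb_nonneg (A : Ω → Prop) : 0 ≤ unifProb A := by
  unfold unifProb; positivity

theorem unifProb_mono {A B : Ω → Prop} (h : ∀ ω, A ω → B ω) : unifProb A ≤ unifProb B := by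
  classical
  simp only [unifProb_eq]
  gcongr
  exact h _

theorem unifProb_eq_zero {A : Ω → Prop} (h : ∀ ω, ¬ A ω) : unifProb A = 0 := by
  classical
  unfold unifProb
  rw [Finset.filter_false_of_mem (fun ω _ => h ω)]
  simp

theorem unifProb_exists_le {ι : Type*} [Fintype ι] (A : ι → Ω → Prop) :
    unifProb (fun ω => ∃ i, A i ω) ≤ ∑ i, unifProb (A i) := by
  classical
  simp only [unifProb_eq]
  rw [← Finset.sum_div]
  gcongr
  have : (Finset.univ.filter fun ω => ∃ i, A i ω)
      ⊆ Finset.univ.biUnion fun i => Finset.univ.filter (A i) := by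
    intro ω hω
    simpa using hω
  exact_mod_cast (Finset.card_le_card this).trans Finset.card_biUnion_le

theorem exists_not_of_unifProb_lt_one [Nonempty Ω] {A : Ω → Prop} (h : unifProb A < 1) :
    ∃ ω, ¬ A ω := by
  classical
  by_contra! hA
  unfold unifProb at h
  rw [Finset.filter_true_of_mem (fun ω _ => hA ω), Finset.card_univ, div_self] at h
  · exact lt_irrefl _ h
  · exact_mod_cast Fintype.card_ne_zero

theorem unifProb_not [Nonempty Ω] (A : Ω → Prop) :
    unifProb (fun ω => ¬ A ω) = 1 - unifProb A := by
  classical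
  have hc : (Fintype.card Ω : ℝ) ≠ 0 := by exact_mod_cast Fintype.card_ne_zero
  have h := Finset.card_filter_add_card_filter_not (s := (Finset.univ : Finset Ω)) A
  rw [Finset.card_univ] at h
  simp only [unifProb_eq]
  rw [eq_sub_iff_add_eq, ← add_div, div_eq_one_iff_eq hc]
  rw [add_comm]
  exact_mod_cast h

end UnifProb

/-- Events depending on disjoint sets of coordinates are independent. -/
theorem unifProb_and_of_disjoint_coords {I R : Type*} [Fintype I] [DecidableEq I] [Fintype R]
    [Nonempty R] (U : Finset I) {A B : (I → R) → Prop}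
    (hA : ∀ ρ ρ' : I → R, (∀ i ∈ U, ρ i = ρ' i) → A ρ → A ρ')
    (hB : ∀ ρ ρ' : I → R, (∀ i ∉ U, ρ i = ρ' i) → B ρ → B ρ') :
    unifProb (fun ρ => A ρ ∧ B ρ) = unifProb A * unifProb B := by
  classical
  have hc : (Fintype.card (I → R) : ℝ) ≠ 0 := by exact_mod_cast Fintype.card_ne_zero
  have key : (Finset.univ.filter fun ρ => A ρ ∧ B ρ).card * Fintype.card (I → R)
      = (Finset.univ.filter A).card * (Finset.univ.filter B).card := by
    rw [← Finset.card_univ, ← Finset.card_product, ← Finset.card_product]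
    -- Exchanging the coordinates outside `U` is an involution on pairs; it matches the pairs with
    -- `A` and `B` on the first entry to those with `A` on the first and `B` on the second.
    let φ : (I → R) × (I → R) → (I → R) × (I → R) := fun p =>
      (fun i => if i ∈ U then p.1 i else p.2 i, fun i => if i ∈ U then p.2 i else p.1 i)
    have hφ : ∀ p, φ (φ p) = p := by
      rintro ⟨ρ, σ⟩
      ext i <;> simp only [φ] <;> split_ifs <;> rfl
    refine Finset.card_bij' (fun p _ => φ p) (fun p _ => φ p) ?_ ?_
      (fun p _ => hφ p) (fun p _ => hφ p)
    · rintro ⟨ρ, σ⟩ h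
      simp only [Finset.mem_product, Finset.mem_filter, Finset.mem_univ, true_and, and_true] at h ⊢
      exact ⟨hA _ _ (fun i hi => by simp [φ, hi]) h.1, hB _ _ (fun i hi => by simp [φ, hi]) h.2⟩
    · rintro ⟨ρ, σ⟩ h
      simp only [Finset.mem_product, Finset.mem_filter, Finset.mem_univ, true_and, and_true] at h ⊢
      exact ⟨hA _ _ (fun i hi => by simp [φ, hi]) h.1, hB _ _ (fun i hi => by simp [φ, hi]) h.2⟩
  simp only [unifProb_eq]
  rw [div_mul_div_comm, div_eq_div_iff hc (mul_ne_zero hc hc)]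
  have key' : ((Finset.univ.filter fun ρ => A ρ ∧ B ρ).card : ℝ) * Fintype.card (I → R)
      = (Finset.univ.filter A).card * (Finset.univ.filter B).card := by exact_mod_cast key
  rw [← key', mul_assoc]

/-! ### Semantics of DNFs -/

/-- The assignment `x` satisfies the term `T`. -/
def SatTerm {V : Type} (x : V → Bool) (T : Term V) : Prop := ∀ l ∈ T, x l.1 = l.2

/-- The assignment `x` satisfies the DNF `D`. -/
def SatDNF {V : Type} (x : V → Bool) (D : DNF V) : Prop := ∃ T ∈ D, SatTerm x T

section Semantics

variable {V : Type}

theorem SatTerm.mono {x : V → Bool} {T T' : Term V} (h : SatTerm x T) (hT : T' ⊆ T) :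
    SatTerm x T' := fun l hl => h l (hT hl)

theorem satDNF_singleton {x : V → Bool} {T : Term V} : SatDNF x {T} ↔ SatTerm x T := by
  simp [SatDNF]

variable [DecidableEq V]

theorem satDNF_union {x : V → Bool} {D E : DNF V} :
    SatDNF x (D ∪ E) ↔ SatDNF x D ∨ SatDNF x E := by
  simp only [SatDNF, Finset.mem_union, or_and_right, exists_or]

theorem satTerm_union {x : V → Bool} {T U : Term V} :
    SatTerm x (T ∪ U) ↔ SatTerm x T ∧ SatTerm x U := by
  simp only [SatTerm, Finset.mem_union, or_imp, forall_and]

theorem satDNF_clauseOf {x : V → Bool} {J : Finset (Literal V)} :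
    SatDNF x (clauseOf J) ↔ ∃ l ∈ J, x l.1 = l.2 := by
  constructor
  · rintro ⟨T, hT, hx⟩
    obtain ⟨l, hl, rfl⟩ := Finset.mem_image.1 hT
    exact ⟨l, hl, hx l (Finset.mem_singleton_self l)⟩
  · rintro ⟨l, hl, hx⟩
    refine ⟨{l}, Finset.mem_image_of_mem _ hl, fun l' hl' => ?_⟩
    rwa [Finset.mem_singleton.1 hl']

/-- The rules of `Res(s)` are sound. -/
theorem ResStep.sound {s : ℕ} {A : Set (DNF V)} {D : DNF V} (h : ResStep s A D) :
    ∃ D₁ ∈ A, ∃ D₂ ∈ A, ∀ x, SatDNF x D₁ → SatDNF x D₂ → SatDNF x D := by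
  cases h with
  | andIntro D₁ D₂ J₁ J₂ h₁ h₂ hs =>
    refine ⟨_, h₁, _, h₂, fun x hx₁ hx₂ => ?_⟩
    simp only [satDNF_union, satDNF_singleton, satTerm_union] at *
    tauto
  | cut D₁ D₂ J h₁ h₂ =>
    refine ⟨_, h₁, _, h₂, fun x hx₁ hx₂ => ?_⟩
    simp only [satDNF_union, satDNF_singleton, satDNF_clauseOf] at *
    rcases hx₁ with hx₁ | ⟨l, hl, hx₁⟩
    · exact Or.inl hx₁
    · rcases hx₂ with hx₂ | hx₂
      · exact Or.inr hx₂
      · have := hx₂ (Literal.neg l) (Finset.mem_image_of_mem _ hl)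
        simp [Literal.neg, hx₁] at this
  | weaken D J h hs =>
    exact ⟨_, h, _, h, fun x hx _ => satDNF_union.2 (Or.inl hx)⟩
  | shrink D J₁ J₂ h =>
    refine ⟨_, h, _, h, fun x hx _ => ?_⟩
    simp only [satDNF_union, satDNF_singleton, satTerm_union] at *
    tauto

/-- The rules of `Res(s)` preserve the bound on the size of terms. -/
theorem ResStep.card_le {s t : ℕ} (hst : s ≤ t) {A : Set (DNF V)} {D : DNF V}
    (h : ResStep s A D) (hA : ∀ E ∈ A, ∀ T ∈ E, T.card ≤ t) : ∀ T ∈ D, T.card ≤ t := by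
  intro T hT
  cases h with
  | andIntro D₁ D₂ J₁ J₂ h₁ h₂ hs =>
    rcases Finset.mem_union.1 hT with hT | hT
    · rcases Finset.mem_union.1 hT with hT | hT
      · exact hA _ h₁ T (Finset.mem_union_left _ hT)
      · exact hA _ h₂ T (Finset.mem_union_left _ hT)
    · rw [Finset.mem_singleton.1 hT]; exact hs.trans hst
  | cut D₁ D₂ J h₁ h₂ =>
    rcases Finset.mem_union.1 hT with hT | hT
    · exact hA _ h₁ T (Finset.mem_union_left _ hT)
    · exact hA _ h₂ T (Finset.mem_union_left _ hT)
  | weaken D J h hs =>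
    rcases Finset.mem_union.1 hT with hT | hT
    · exact hA _ h T hT
    · rw [Finset.mem_singleton.1 hT]; exact hs.trans hst
  | shrink D J₁ J₂ h =>
    rcases Finset.mem_union.1 hT with hT | hT
    · exact hA _ h T (Finset.mem_union_left _ hT)
    · rw [Finset.mem_singleton.1 hT]
      exact (Finset.card_le_card Finset.subset_union_left).trans
        (hA _ h _ (Finset.mem_union_right _ (Finset.mem_singleton_self _)))

/-- All terms in a `Res(s)` refutation are small if those of the initial DNFs are. -/
theorem ResRefutation.card_le {s t : ℕ} (hst : s ≤ t) {F : Set (DNF V)}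
    (π : ResRefutation s F) (hF : ∀ E ∈ F, ∀ T ∈ E, T.card ≤ t) (i : Fin π.size) :
    ∀ T ∈ π.line i, T.card ≤ t := by
  induction i using WellFoundedLT.induction with
  | _ i ih =>
    refine (π.derived i).card_le hst ?_
    rintro E (hE | ⟨j, hj, rfl⟩)
    · exact hF E hE
    · exact ih j hj

end Semantics

/-! ### Random restrictions -/

/-- A restriction: every pigeon receives `s` bit positions and values for its bits, of which only
those at the chosen positions matter. -/
abbrev Restriction (I : Type) (k s : ℕ) := I → (Fin s → Fin k) × (Fin k → Bool)

namespace Restriction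

variable {I : Type} {k s : ℕ}

/-- The hole `h` agrees with the bits that `ρ` fixes for the pigeon `i`. -/
def Allows (ρ : Restriction I k s) (i : I) (h : Fin k → Bool) : Prop :=
  ∀ j, h ((ρ i).1 j) = (ρ i).2 ((ρ i).1 j)

/-- The restriction `ρ` makes all literals of `T` true. -/
def Forces (ρ : Restriction I k s) (T : Term (I × Fin k)) : Prop :=
  ∀ l ∈ T, (∃ j, (ρ l.1.1).1 j = l.1.2) ∧ (ρ l.1.1).2 l.1.2 = l.2

theorem Allows.eq_of_forces {ρ : Restriction I k s} {T : Term (I × Fin k)} (h : ρ.Forces T)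
    {l : Literal (I × Fin k)} (hl : l ∈ T) {a : Fin k → Bool} (ha : ρ.Allows l.1.1 a) :
    a l.1.2 = l.2 := by
  obtain ⟨⟨j, hj⟩, hv⟩ := h l hl
  rw [← hv, ← hj]
  exact ha j

/-- Many holes are left to every pigeon: one of them avoids any small set of holes. -/
theorem exists_allows_notMem (ρ : Restriction I k s) (i : I) (B : Finset (Fin k → Bool))
    (hB : B.card < 2 ^ (k - s)) : ∃ h ∉ B, ρ.Allows i h := by
  classical
  by_contra! hc
  let R : Finset (Fin k) := Finset.univ.image (ρ i).1
  have hR : R.card ≤ s := by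
    simpa using Finset.card_image_le (s := (Finset.univ : Finset (Fin s))) (f := (ρ i).1)
  -- Every filling of the unchosen bits is an allowed hole, and different fillings give different
  -- holes.
  let φ : ({b // b ∉ R} → Bool) → (Fin k → Bool) :=
    fun u b => if hb : b ∈ R then (ρ i).2 b else u ⟨b, hb⟩
  have hφ : Function.Injective φ := by
    intro u v huv
    ext ⟨b, hb⟩
    have := congrFun huv b
    simpa [φ, hb] using this
  have hsub : Finset.univ.image φ ⊆ B := by
    intro h hh
    obtain ⟨u, -, rfl⟩ := Finset.mem_image.1 hh
    by_contra hn
    refine hc _ hn fun j => ?_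
    have : (ρ i).1 j ∈ R := Finset.mem_image_of_mem _ (Finset.mem_univ j)
    simp [φ, this]
  have h1 := Finset.card_le_card hsub
  rw [Finset.card_image_of_injective _ hφ, Finset.card_univ, Fintype.card_fun,
    Fintype.card_bool, Fintype.card_subtype_compl, Fintype.card_fin, Fintype.card_coe] at h1
  have h2 : 2 ^ (k - s) ≤ 2 ^ (k - R.card) := Nat.pow_le_pow_right (by norm_num) (by omega)
  omega

variable [Fintype I] [DecidableEq I]

/-- A satisfiable term with at most `s` literals is made true by a random restriction with
probability at least `(2k)⁻ˢ`. -/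
theorem inv_le_unifProb_forces (T : Term (I × Fin k)) (hT : T.card ≤ s) (hne : T.Nonempty)
    (y : I → Fin k → Bool) (hy : SatTerm (fun v => y v.1 v.2) T) :
    (((2 * k : ℕ) : ℝ) ^ s)⁻¹ ≤ unifProb (fun ρ : Restriction I k s => ρ.Forces T) := by
  classical
  obtain ⟨l₀, hl₀⟩ := hne
  have : Nonempty (Fin k) := ⟨l₀.1.2⟩
  have hk : 0 < k := Fin.pos_iff_nonempty.2 inferInstance
  obtain ⟨L, hL⟩ : ∃ L : Fin s → {l // l ∈ T}, Function.Surjective L := by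
    have : Nonempty {l // l ∈ T} := ⟨⟨l₀, hl₀⟩⟩
    obtain ⟨f⟩ : Nonempty ({l // l ∈ T} ↪ Fin s) :=
      Function.Embedding.nonempty_of_card_le (by simpa using hT)
    exact ⟨Function.invFun f, Function.invFun_surjective f.injective⟩
  -- Slot `j` of the pigeon of the `j`-th literal is redirected to that literal's bit, whose value
  -- is set to satisfy it. `lost` keeps the overwritten data, one of `(2k)ˢ` possibilities, so every
  -- forcing restriction arises at most `(2k)ˢ` times.
  let plant : Restriction I k s → Restriction I k s := fun ρ i =>
    (fun j => if (L j).1.1.1 = i then (L j).1.1.2 else (ρ i).1 j,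
     fun b => if ∃ j, (L j).1.1 = (i, b) then y i b else (ρ i).2 b)
  let lost : Restriction I k s → (Fin s → Fin k × Bool) := fun ρ j =>
    ((ρ (L j).1.1.1).1 j, (ρ (L j).1.1.1).2 (L j).1.1.2)
  have hplant : ∀ ρ, (plant ρ).Forces T := by
    intro ρ l hl
    obtain ⟨j, hj⟩ := hL ⟨l, hl⟩
    have hj' : (L j).1 = l := by rw [hj]
    have h2 : ∃ j, (L j).1.1 = (l.1.1, l.1.2) := ⟨j, by rw [hj']⟩
    refine ⟨⟨j, by simp [plant, hj']⟩, ?_⟩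
    simp only [plant]
    rw [if_pos h2]
    exact hy l hl
  have hinj : Function.Injective fun ρ => (plant ρ, lost ρ) := by
    intro ρ σ h
    obtain ⟨hp, hl⟩ := Prod.mk.inj h
    funext i
    refine Prod.ext (funext fun j => ?_) (funext fun b => ?_)
    · by_cases hij : (L j).1.1.1 = i
      · have := congrArg Prod.fst (congrFun hl j)
        simp only [lost] at this
        rwa [hij] at this
      · have := congrFun (congrArg Prod.fst (congrFun hp i)) j
        simpa only [plant, if_neg hij] using this
    · by_cases hib : ∃ j, (L j).1.1 = (i, b)
      · obtain ⟨j, hj⟩ := hib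
        have := congrArg Prod.snd (congrFun hl j)
        simp only [lost] at this
        rwa [hj] at this
      · have := congrFun (congrArg Prod.snd (congrFun hp i)) b
        simpa only [plant, if_neg hib] using this
  have hcard : Fintype.card (Restriction I k s) ≤
      (Finset.univ.filter fun ρ : Restriction I k s => ρ.Forces T).card * (2 * k) ^ s := by
    have h1 := Finset.card_le_card_of_injOn
      (s := (Finset.univ : Finset (Restriction I k s)))
      (t := (Finset.univ.filter fun ρ : Restriction I k s => ρ.Forces T) ×ˢ
        (Finset.univ : Finset (Fin s → Fin k × Bool)))
      (fun ρ => (plant ρ, lost ρ)) (fun ρ _ => by simp [hplant]) hinj.injOn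
    rw [Finset.card_product, Finset.card_univ, Finset.card_univ] at h1
    simpa [mul_comm] using h1
  have hc : (0 : ℝ) < Fintype.card (Restriction I k s) := by exact_mod_cast Fintype.card_pos
  have hC : (0 : ℝ) < ((2 * k : ℕ) : ℝ) ^ s := by positivity
  rw [unifProb_eq, le_div_iff₀ hc, inv_mul_le_iff₀ hC, mul_comm]
  exact_mod_cast hcard

/-- Either a random restriction is likely to make one of the terms in `𝒜` true, or all terms in
`𝒜` are met by few pigeons. -/
theorem forces_or_cover (N : ℕ) (𝒜 : Finset (Term (I × Fin k))) (hs : ∀ T ∈ 𝒜, T.card ≤ s)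
    (hne : ∀ T ∈ 𝒜, T.Nonempty)
    (hsat : ∀ T ∈ 𝒜, ∃ y : I → Fin k → Bool, SatTerm (fun v => y v.1 v.2) T) :
    unifProb (fun ρ : Restriction I k s => ∀ T ∈ 𝒜, ¬ ρ.Forces T) ≤
        (1 - (((2 * k : ℕ) : ℝ) ^ s)⁻¹) ^ N ∨
      ∃ S : Finset I, S.card ≤ s * N ∧ ∀ T ∈ 𝒜, ∃ l ∈ T, l.1.1 ∈ S := by
  induction N generalizing 𝒜 with
  | zero =>
    rcases isEmpty_or_nonempty (Restriction I k s) with h | h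
    · exact Or.inl ((unifProb_eq_zero fun ω => h.elim ω).trans_le (by norm_num))
    · left
      have := unifProb_not (Ω := Restriction I k s) (fun ρ => ¬ ∀ T ∈ 𝒜, ¬ ρ.Forces T)
      simp only [not_not] at this
      rw [this, pow_zero]
      linarith [unifProb_nonneg (fun ρ : Restriction I k s => ¬ ∀ T ∈ 𝒜, ¬ ρ.Forces T)]
  | succ N ih =>
    rcases 𝒜.eq_empty_or_nonempty with rfl | ⟨T, hT⟩
    · exact Or.inr ⟨∅, by simp, by simp⟩
    let U : Finset I := T.image fun l => l.1.1
    have hU : U.card ≤ s := Finset.card_image_le.trans (hs T hT)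
    -- Greedy choice: terms avoiding the pigeons of `T` are independent of `T`, and all others are
    -- covered by `U` at a cost of at most `s` pigeons.
    let ℬ := 𝒜.filter fun T' => ∀ l ∈ T', l.1.1 ∉ U
    have hℬ : ∀ T' ∈ ℬ, T' ∈ 𝒜 := fun T' h => (Finset.mem_filter.1 h).1
    rcases ih ℬ (fun T' h => hs T' (hℬ T' h)) (fun T' h => hne T' (hℬ T' h))
      (fun T' h => hsat T' (hℬ T' h)) with h | ⟨S, hS, hcov⟩
    · left
      obtain ⟨y, hy⟩ := hsat T hT
      have : Nonempty (Fin k) := ⟨(hne T hT).choose.1.2⟩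
      have hp := inv_le_unifProb_forces T (hs T hT) (hne T hT) y hy
      calc unifProb (fun ρ : Restriction I k s => ∀ T ∈ 𝒜, ¬ ρ.Forces T)
          ≤ unifProb (fun ρ : Restriction I k s => ¬ ρ.Forces T ∧ ∀ T' ∈ ℬ, ¬ ρ.Forces T') :=
            unifProb_mono fun ρ hρ => ⟨hρ T hT, fun T' hT' => hρ T' (hℬ T' hT')⟩
        _ = unifProb (fun ρ : Restriction I k s => ¬ ρ.Forces T) *
              unifProb (fun ρ : Restriction I k s => ∀ T' ∈ ℬ, ¬ ρ.Forces T') := by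
            refine unifProb_and_of_disjoint_coords U ?_ ?_
            · intro ρ ρ' h hρ hρ'
              refine hρ fun l hl => ?_
              rw [h l.1.1 (Finset.mem_image_of_mem _ hl)]
              exact hρ' l hl
            · intro ρ ρ' h hρ T' hT' hρ'
              refine hρ T' hT' fun l hl => ?_
              rw [h l.1.1 ((Finset.mem_filter.1 hT').2 l hl)]
              exact hρ' l hl
        _ ≤ (1 - (((2 * k : ℕ) : ℝ) ^ s)⁻¹) * (1 - (((2 * k : ℕ) : ℝ) ^ s)⁻¹) ^ N := by
            have h1 : unifProb (fun ρ : Restriction I k s => ¬ ρ.Forces T) ≤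
                1 - (((2 * k : ℕ) : ℝ) ^ s)⁻¹ := by
              rw [unifProb_not]; linarith
            exact mul_le_mul h1 h (unifProb_nonneg _) ((unifProb_nonneg _).trans h1)
        _ = _ := by rw [pow_succ']
    · right
      refine ⟨U ∪ S, (Finset.card_union_le _ _).trans ?_, fun T' hT' => ?_⟩
      · rw [mul_add, mul_one]; omega
      · by_cases hd : ∀ l ∈ T', l.1.1 ∉ U
        · obtain ⟨l, hl, hlS⟩ := hcov T' (Finset.mem_filter.2 ⟨hT', hd⟩)
          exact ⟨l, hl, Finset.mem_union_right _ hlS⟩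
        · push Not at hd
          obtain ⟨l, hl, hlU⟩ := hd
          exact ⟨l, hl, Finset.mem_union_left _ hlU⟩

/-! ### Decision trees querying pigeons -/

/-- Under the restriction `ρ`, the DNF `D` has the value `b` as soon as the pigeons in `P` go to
the holes given by `x`. -/
def Fixes (ρ : Restriction I k s) (D : DNF (I × Fin k)) (P : Finset I) (x : I → Fin k → Bool)
    (b : Prop) : Prop :=
  ∀ z : I → Fin k → Bool, (∀ i ∈ P, z i = x i) → (∀ i ∉ P, ρ.Allows i (z i)) →
    (SatDNF (fun v => z v.1 v.2) D ↔ b)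

/-- Under the restriction `ρ`, and when the pigeons in `P` go to the holes given by `x`, the value
of the DNF `D` can be determined by a decision tree that asks for the holes of at most `h` further
pigeons. -/
inductive Decided (ρ : Restriction I k s) (D : DNF (I × Fin k)) :
    ℕ → Finset I → (I → Fin k → Bool) → Prop
  | leaf (h : ℕ) (P : Finset I) (x : I → Fin k → Bool) (b : Prop) (hb : ρ.Fixes D P x b) :
      Decided ρ D h P x
  | query (h h' : ℕ) (P S : Finset I) (x : I → Fin k → Bool) (hS : S.card + h' ≤ h)
      (hg : ∀ g : S → Fin k → Bool,
        Decided ρ D h' (P ∪ S) (fun i => if hi : i ∈ S then g ⟨i, hi⟩ else x i)) :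
      Decided ρ D h P x

end Restriction

/-! ### Live terms, legal placements and the switching lemma -/

namespace Restriction

variable {I : Type} {k s : ℕ}

/-- The term `T` is satisfiable and not falsified when the pigeons in `P` go to the holes given
by `x`. -/
def Alive (P : Finset I) (x : I → Fin k → Bool) (T : Term (I × Fin k)) : Prop :=
  (∀ l ∈ T, l.1.1 ∈ P → x l.1.1 l.1.2 = l.2) ∧
    ∃ y : I → Fin k → Bool, SatTerm (fun v => y v.1 v.2) T

theorem alive_of_satTerm {P : Finset I} {x z : I → Fin k → Bool} {T : Term (I × Fin k)}
    (hz : ∀ i ∈ P, z i = x i) (h : SatTerm (fun v => z v.1 v.2) T) : Alive P x T :=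
  ⟨fun l hl hP => by rw [← hz _ hP]; exact h l hl, z, h⟩

/-- The pigeons in `P` go to different holes, as `ρ` allows. -/
def Legal (ρ : Restriction I k s) (P : Finset I) (x : I → Fin k → Bool) : Prop :=
  (∀ i ∈ P, ρ.Allows i (x i)) ∧ ∀ i ∈ P, ∀ j ∈ P, x i = x j → i = j

theorem Legal.mono {ρ : Restriction I k s} {P Q : Finset I} {x y : I → Fin k → Bool}
    (h : ρ.Legal P x) (hQ : Q ⊆ P) (hxy : ∀ i ∈ Q, y i = x i) : ρ.Legal Q y := by
  refine ⟨fun i hi => ?_, fun i hi j hj hij => ?_⟩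
  · rw [hxy i hi]; exact h.1 i (hQ hi)
  · rw [hxy i hi, hxy j hj] at hij
    exact h.2 i (hQ hi) j (hQ hj) hij

variable [DecidableEq I]

/-- Literals at placed pigeons hold because the term is alive, the remaining ones because `ρ` forces
them. -/
theorem fixes_true_of_forces {ρ : Restriction I k s} {D : DNF (I × Fin k)} {P : Finset I}
    {x : I → Fin k → Bool} {T : Term (I × Fin k)} (hT : T ∈ D) (ha : Alive P x T)
    (hf : ρ.Forces (T.filter fun l => l.1.1 ∉ P)) : ρ.Fixes D P x True := by
  intro z hz hz'
  refine iff_of_true ⟨T, hT, fun l hl => ?_⟩ trivial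
  by_cases hP : l.1.1 ∈ P
  · simp only [hz _ hP]
    exact ha.1 l hl hP
  · exact Allows.eq_of_forces hf (Finset.mem_filter.2 ⟨hl, hP⟩) (hz' _ hP)

theorem one_sub_inv_pow_le_half_pow {C : ℕ} (hC : 0 < C) (e : ℕ) :
    (1 - (C : ℝ)⁻¹) ^ (C * e) ≤ (1 / 2) ^ e := by
  have hC1 : (1 : ℝ) ≤ C := by exact_mod_cast hC
  have h0 : (0 : ℝ) ≤ 1 - (C : ℝ)⁻¹ := sub_nonneg.2 (inv_le_one_of_one_le₀ hC1)
  rw [pow_mul]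
  refine pow_le_pow_left₀ (by positivity) ?_ e
  have h := Real.one_sub_div_pow_le_exp_neg hC1
  rw [one_div] at h
  refine h.trans ?_
  rw [Real.exp_neg, one_div]
  refine inv_anti₀ (by norm_num) ?_
  linarith [Real.add_one_le_exp (1 : ℝ)]

/-- The factor by which the number of queried pigeons grows for every literal of a term. -/
def growth (k s : ℕ) : ℕ := 1 + k * (s * (2 * k) ^ s)

theorem growth_pos (k s : ℕ) : 0 < growth k s := by unfold growth; omega

/-- Switching lemma: if at most `r` literals are left in every term of `D` that is alive, then under
a random restriction `D` is very likely to be decided by few queries. -/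
theorem unifProb_not_decided_le [Fintype I] (hk : 0 < k) (D : DNF (I × Fin k)) (hD : ∀ T ∈ D, T.card ≤ s)
    (r : ℕ) : ∀ (e : ℕ) (P : Finset I) (x : I → Fin k → Bool),
      (∀ T ∈ D, Alive P x T → (T.filter fun l => l.1.1 ∉ P).card ≤ r) →
      unifProb (fun ρ : Restriction I k s =>
        ¬ ρ.Decided D (e * growth k s ^ r - e) P x) ≤ (1 / 2) ^ e := by
  classical
  induction r with
  | zero =>
    intro e P x hr
    rw [unifProb_eq_zero]
    · positivity
    · intro ρ
      rw [not_not]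
      by_cases h : ∃ T ∈ D, Alive P x T
      · obtain ⟨T, hT, ha⟩ := h
        refine .leaf _ _ _ True (fixes_true_of_forces hT ha ?_)
        rw [Finset.card_eq_zero.1 (Nat.le_zero.1 (hr T hT ha))]
        simp [Forces]
      · refine .leaf _ _ _ False fun z hz _ => iff_of_false ?_ id
        rintro ⟨T, hT, hs⟩
        exact h ⟨T, hT, alive_of_satTerm hz hs⟩
  | succ r ih =>
    intro e P x hr
    by_cases h0 : ∃ T ∈ D, Alive P x T ∧ (T.filter fun l => l.1.1 ∉ P) = ∅
    · obtain ⟨T, hT, ha, h0⟩ := h0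
      rw [unifProb_eq_zero]
      · positivity
      · intro ρ
        rw [not_not]
        refine .leaf _ _ _ True (fixes_true_of_forces hT ha ?_)
        rw [h0]
        simp [Forces]
    push Not at h0
    let 𝒜 : Finset (Term (I × Fin k)) :=
      (D.filter fun T => Alive P x T).image fun T => T.filter fun l => l.1.1 ∉ P
    have h𝒜 : ∀ T' ∈ 𝒜, ∃ T ∈ D, Alive P x T ∧ (T.filter fun l => l.1.1 ∉ P) = T' := by
      intro T' hT'
      obtain ⟨T, hT, rfl⟩ := Finset.mem_image.1 hT'
      obtain ⟨hT, ha⟩ := Finset.mem_filter.1 hT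
      exact ⟨T, hT, ha, rfl⟩
    have hmem : ∀ T ∈ D, Alive P x T → (T.filter fun l => l.1.1 ∉ P) ∈ 𝒜 := fun T hT ha =>
      Finset.mem_image_of_mem _ (Finset.mem_filter.2 ⟨hT, ha⟩)
    have h𝒜s : ∀ T' ∈ 𝒜, T'.card ≤ s := by
      intro T' hT'
      obtain ⟨T, hT, -, rfl⟩ := h𝒜 T' hT'
      exact (Finset.card_filter_le _ _).trans (hD T hT)
    have h𝒜ne : ∀ T' ∈ 𝒜, T'.Nonempty := by
      intro T' hT'
      obtain ⟨T, hT, ha, rfl⟩ := h𝒜 T' hT'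
      exact h0 T hT ha
    have h𝒜sat : ∀ T' ∈ 𝒜, ∃ y : I → Fin k → Bool, SatTerm (fun v => y v.1 v.2) T' := by
      intro T' hT'
      obtain ⟨T, hT, ha, rfl⟩ := h𝒜 T' hT'
      obtain ⟨y, hy⟩ := ha.2
      exact ⟨y, hy.mono (Finset.filter_subset _ _)⟩
    -- With success probability at least `(2k)⁻ˢ` each, `(2k)ˢ e` independent terms all fail with
    -- probability at most `2⁻ᵉ`.
    rcases forces_or_cover ((2 * k) ^ s * e) 𝒜 h𝒜s h𝒜ne h𝒜sat with h | ⟨S₀, hS₀, hcov⟩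
    · have hC := one_sub_inv_pow_le_half_pow (C := (2 * k) ^ s) (by positivity) e
      rw [Nat.cast_pow] at hC
      refine le_trans (unifProb_mono fun ρ hρ T' hT' hf => hρ ?_) (h.trans hC)
      obtain ⟨T, hT, ha, rfl⟩ := h𝒜 T' hT'
      exact .leaf _ _ _ True (fixes_true_of_forces hT ha hf)
    -- Removing `P` keeps the answers from overwriting earlier placements; the cover still works
    -- because the trimmed terms only mention pigeons outside `P`.
    · let S := S₀ \ P
      have hS : S.card ≤ s * ((2 * k) ^ s * e) :=
        (Finset.card_le_card Finset.sdiff_subset).trans hS₀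
      let y : (S → Fin k → Bool) → I → Fin k → Bool :=
        fun g i => if hi : i ∈ S then g ⟨i, hi⟩ else x i
      have hy : ∀ g, ∀ i ∈ P, y g i = x i := by
        intro g i hi
        have : i ∉ S := fun h => (Finset.mem_sdiff.1 h).2 hi
        simp only [y, dif_neg this]
      have hstep : ∀ g, unifProb (fun ρ : Restriction I k s =>
          ¬ ρ.Decided D (e * growth k s * growth k s ^ r - e * growth k s) (P ∪ S) (y g)) ≤
            (1 / 2) ^ (e * growth k s) := by
        intro g
        refine ih _ _ _ fun T hT ha => ?_
        have ha' : Alive P x T :=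
          ⟨fun l hl hP => by
            rw [← hy g _ hP]; exact ha.1 l hl (Finset.mem_union_left _ hP), ha.2⟩
        obtain ⟨l, hl, hlS⟩ := hcov _ (hmem T hT ha')
        have hlP := (Finset.mem_filter.1 hl).2
        have hlt : (T.filter fun l => l.1.1 ∉ P ∪ S).card <
            (T.filter fun l => l.1.1 ∉ P).card := by
          refine Finset.card_lt_card (Finset.ssubset_iff_subset_ne.2 ⟨?_, fun heq => ?_⟩)
          · exact Finset.monotone_filter_right _ fun a _ h hP => h (Finset.mem_union_left _ hP)
          · rw [← heq] at hl
            exact (Finset.mem_filter.1 hl).2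
              (Finset.mem_union_right _ (Finset.mem_sdiff.2 ⟨hlS, hlP⟩))
        have := hr T hT ha'
        omega
      -- `growth` is chosen for this identity: the surplus over `e` pays exactly for a union bound
      -- over the at most `2 ^ (k * (s * ((2k)ˢ * e)))` answers to the query `S`.
      have hG : e * growth k s = e + k * (s * ((2 * k) ^ s * e)) := by unfold growth; ring
      -- The subtracted `e` makes the heights telescope, as `S` has at most `e * growth k s - e`
      -- elements.
      have hheight : S.card + (e * growth k s * growth k s ^ r - e * growth k s) ≤
          e * growth k s ^ (r + 1) - e := by
        have h1 : e * growth k s ^ (r + 1) = e * growth k s * growth k s ^ r := by ring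
        have h2 : e * growth k s ≤ e * growth k s * growth k s ^ r :=
          Nat.le_mul_of_pos_right _ (Nat.pow_pos (growth_pos k s))
        have h3 : s * ((2 * k) ^ s * e) ≤ k * (s * ((2 * k) ^ s * e)) :=
          Nat.le_mul_of_pos_left _ hk
        omega
      calc unifProb (fun ρ : Restriction I k s =>
            ¬ ρ.Decided D (e * growth k s ^ (r + 1) - e) P x)
          ≤ unifProb (fun ρ : Restriction I k s => ∃ g,
              ¬ ρ.Decided D (e * growth k s * growth k s ^ r - e * growth k s) (P ∪ S) (y g)) := by
            refine unifProb_mono fun ρ hρ => ?_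
            by_contra! hc
            exact hρ (.query _ _ _ S _ hheight hc)
        _ ≤ ∑ g : S → Fin k → Bool, unifProb (fun ρ : Restriction I k s =>
              ¬ ρ.Decided D (e * growth k s * growth k s ^ r - e * growth k s) (P ∪ S) (y g)) :=
            unifProb_exists_le _
        _ ≤ ∑ _g : S → Fin k → Bool, (1 / 2 : ℝ) ^ (e * growth k s) :=
            Finset.sum_le_sum fun g _ => hstep g
        _ = (2 : ℝ) ^ (k * S.card) * (1 / 2) ^ (e * growth k s) := by
            simp [pow_mul]
        _ ≤ (2 : ℝ) ^ (k * (s * ((2 * k) ^ s * e))) * (1 / 2) ^ (e * growth k s) := by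
            gcongr
            norm_num
        _ = (1 / 2) ^ e := by
            rw [hG, pow_add (1 / 2 : ℝ), mul_left_comm, ← mul_pow]
            norm_num

/-! ### The adversary -/

/-- Further pigeons can be placed as long as there are not too many of them. -/
theorem Legal.extend {ρ : Restriction I k s} {P : Finset I} {x : I → Fin k → Bool}
    (h : ρ.Legal P x) (S : Finset I) (hc : P.card + S.card ≤ 2 ^ (k - s)) :
    ∃ y, ρ.Legal (P ∪ S) y ∧ ∀ i ∈ P, y i = x i := by
  induction S using Finset.induction_on with
  | empty => exact ⟨x, by simpa using h, fun _ _ => rfl⟩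
  | insert a S ha ih =>
    rw [Finset.card_insert_of_notMem ha] at hc
    obtain ⟨y, hy, hyx⟩ := ih (by omega)
    by_cases haP : a ∈ P
    · refine ⟨y, ?_, hyx⟩
      rwa [Finset.union_insert, Finset.insert_eq_of_mem (Finset.mem_union_left _ haP)]
    · have haPS : a ∉ P ∪ S := by simp [haP, ha]
      have hB : ((P ∪ S).image y).card < 2 ^ (k - s) :=
        (Finset.card_image_le.trans (Finset.card_union_le _ _)).trans_lt (by omega)
      obtain ⟨t, ht, hta⟩ := ρ.exists_allows_notMem a _ hB
      have hne : ∀ i ∈ P ∪ S, i ≠ a := fun i hi hia => haPS (hia ▸ hi)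
      have hnt : ∀ i ∈ P ∪ S, y i ≠ t := fun i hi hit => ht (hit ▸ Finset.mem_image_of_mem y hi)
      refine ⟨Function.update y a t, ⟨fun i hi => ?_, fun i hi j hj hij => ?_⟩, fun i hi => ?_⟩
      · rw [Finset.union_insert, Finset.mem_insert] at hi
        rcases hi with rfl | hi
        · simpa using hta
        · rw [Function.update_of_ne (hne i hi)]; exact hy.1 i hi
      · rw [Finset.union_insert, Finset.mem_insert] at hi hj
        rcases hi with rfl | hi <;> rcases hj with rfl | hj
        · rfl
        · rw [Function.update_self, Function.update_of_ne (hne j hj)] at hij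
          exact absurd hij.symm (hnt j hj)
        · rw [Function.update_self, Function.update_of_ne (hne i hi)] at hij
          exact absurd hij (hnt i hi)
        · rw [Function.update_of_ne (hne i hi), Function.update_of_ne (hne j hj)] at hij
          exact hy.2 i hi j hj hij
      · rw [Function.update_of_ne (hne i (Finset.mem_union_left _ hi))]
        exact hyx i hi

/-- The adversary answers the queries of a decision tree. -/
theorem Decided.walk {ρ : Restriction I k s} {D : DNF (I × Fin k)} {h : ℕ} {Q : Finset I}
    {q : I → Fin k → Bool} (hd : ρ.Decided D h Q q) :
    ∀ (P : Finset I) (x : I → Fin k → Bool), ρ.Legal P x → Q ⊆ P → (∀ i ∈ Q, q i = x i) →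
      P.card + h ≤ 2 ^ (k - s) →
      ∃ (P' Q' : Finset I) (x' : I → Fin k → Bool) (b : Prop), ρ.Legal P' x' ∧ P ⊆ P' ∧
        Q' ⊆ P' ∧ (∀ i ∈ P, x' i = x i) ∧ P'.card ≤ P.card + h ∧ Q'.card ≤ Q.card + h ∧
        ρ.Fixes D Q' x' b := by
  induction hd with
  | leaf h Q q b hb =>
    intro P x hP hQ hq _
    refine ⟨P, Q, x, b, hP, subset_rfl, hQ, fun _ _ => rfl, by omega, by omega, ?_⟩
    exact fun z hz hz' => hb z (fun i hi => by rw [hz i hi, hq i hi]) hz'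
  | query h h' Q S q hS hg ih =>
    intro P x hP hQ hq hc
    -- Queried pigeons already in `P` are answered by their present hole; only new ones get a fresh
    -- hole.
    obtain ⟨y, hy, hyx⟩ := hP.extend S (by omega)
    have hc1 := Finset.card_union_le P S
    have hc2 := Finset.card_union_le Q S
    obtain ⟨P', Q', x', b, h1, h2, h3, h4, h5, h6, h7⟩ := ih (fun i => y i) (P ∪ S) y hy
      (Finset.union_subset_union_left hQ) (by
        intro i hi
        by_cases hiS : i ∈ S
        · simp [hiS]
        · have hiQ : i ∈ Q := (Finset.mem_union.1 hi).resolve_right hiS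
          simp only [dif_neg hiS]
          rw [hyx i (hQ hiQ), hq i hiQ]) (by omega)
    exact ⟨P', Q', x', b, h1, Finset.subset_union_left.trans h2, h3,
      fun i hi => by rw [h4 i (Finset.mem_union_left _ hi), hyx i hi], by omega, by omega, h7⟩

/-- The DNF `D` is false under `ρ` and some legal placement of at most `h` pigeons. -/
def Refutable (ρ : Restriction I k s) (h : ℕ) (D : DNF (I × Fin k)) : Prop :=
  ∃ (P : Finset I) (x : I → Fin k → Bool), ρ.Legal P x ∧ P.card ≤ h ∧ ρ.Fixes D P x False

/-- An assignment that `ρ` allows and that extends a legal placement. -/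
theorem Legal.exists_total {ρ : Restriction I k s} {P : Finset I} {x : I → Fin k → Bool}
    (h : ρ.Legal P x) :
    ∃ z : I → Fin k → Bool, (∀ i ∈ P, z i = x i) ∧ ∀ i, ρ.Allows i (z i) := by
  refine ⟨fun i => if i ∈ P then x i else (ρ i).2, fun i hi => by simp [hi], fun i => ?_⟩
  by_cases hi : i ∈ P
  · simpa [hi] using h.1 i hi
  · simp [hi, Allows]

/-- If the conclusion of a sound inference is refutable, then so is one of the premises. -/
theorem Refutable.of_sound {ρ : Restriction I k s} {h : ℕ} (hh : 3 * h ≤ 2 ^ (k - s))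
    {D D₁ D₂ : DNF (I × Fin k)} (hD : ρ.Refutable h D) (x₀ : I → Fin k → Bool)
    (h₁ : ρ.Decided D₁ h ∅ x₀) (h₂ : ρ.Decided D₂ h ∅ x₀)
    (hs : ∀ x, SatDNF x D₁ → SatDNF x D₂ → SatDNF x D) :
    ρ.Refutable h D₁ ∨ ρ.Refutable h D₂ := by
  obtain ⟨P, x, hP, hPh, hF⟩ := hD
  obtain ⟨P₁, Q₁, x₁, b₁, hP₁, hPP₁, hQ₁, hx₁, hc₁, hq₁, hF₁⟩ :=
    h₁.walk P x hP (Finset.empty_subset _) (by simp) (by omega)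
  obtain ⟨P₂, Q₂, x₂, b₂, hP₂, hPP₂, hQ₂, hx₂, hc₂, hq₂, hF₂⟩ :=
    h₂.walk P₁ x₁ hP₁ (Finset.empty_subset _) (by simp) (by omega)
  -- Pigeons outside `P₂` may collide under `z`: soundness holds for all assignments.
  obtain ⟨z, hz, hza⟩ := hP₂.exists_total
  have e : SatDNF (fun v => z v.1 v.2) D ↔ False := hF z
    (fun i hi => by rw [hz i (hPP₂ (hPP₁ hi)), hx₂ i (hPP₁ hi), hx₁ i hi]) fun i _ => hza i
  have e₁ := hF₁ z (fun i hi => by rw [hz i (hPP₂ (hQ₁ hi)), hx₂ i (hQ₁ hi)]) fun i _ => hza i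
  have e₂ := hF₂ z (fun i hi => hz i (hQ₂ hi)) fun i _ => hza i
  rw [Finset.card_empty, zero_add] at hq₁ hq₂
  by_cases hb₁ : b₁
  · by_cases hb₂ : b₂
    · exact absurd (hs _ (e₁.2 hb₁) (e₂.2 hb₂)) e.1
    -- Only the branch of the falsified premise is kept, which brings the number of pigeons back to
    -- at most `h`.
    · refine Or.inr ⟨Q₂, x₂, hP₂.mono hQ₂ fun _ _ => rfl, hq₂, ?_⟩
      exact fun z hz hz' => (hF₂ z hz hz').trans (iff_false_intro hb₂)
  · refine Or.inl ⟨Q₁, x₁, hP₁.mono hQ₁ fun _ _ => rfl, hq₁, ?_⟩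
    exact fun z hz hz' => (hF₁ z hz hz').trans (iff_false_intro hb₁)

end Restriction

/-! ### The size lower bound -/

theorem satDNF_clauseOf_avoidHole {m k : ℕ} {i j : Fin m} (a : Fin (2 ^ k))
    {z : Fin m → Fin k → Bool} :
    SatDNF (fun v => z v.1 v.2) (clauseOf (avoidHole i a ∪ avoidHole j a)) ↔
      z i ≠ bin a ∨ z j ≠ bin a := by
  have key : ∀ i : Fin m, (∃ l ∈ avoidHole i a, z l.1.1 l.1.2 = l.2) ↔ z i ≠ bin a := by
    intro i
    rw [Function.ne_iff]
    simp only [avoidHole, Finset.mem_image, Finset.mem_univ, true_and, exists_exists_eq_and]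
    exact exists_congr fun b => by cases z i b <;> cases bin a b <;> simp
  rw [satDNF_clauseOf, ← key i, ← key j]
  simp only [Finset.mem_union, or_and_right, exists_or]

theorem card_le_one_of_mem_binPHP {m k : ℕ} {E : DNF (Fin m × Fin k)} (hE : E ∈ BinPHP m k) :
    ∀ T ∈ E, T.card ≤ 1 := by
  obtain ⟨i, j, a, -, rfl⟩ := hE
  intro T hT
  obtain ⟨l, -, rfl⟩ := Finset.mem_image.1 hT
  simp

namespace Restriction

variable {m k s : ℕ}

theorem decided_of_mem_binPHP (ρ : Restriction (Fin m) k s) {E : DNF (Fin m × Fin k)}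
    (hE : E ∈ BinPHP m k) {h : ℕ} (hh : 2 ≤ h) (x : Fin m → Fin k → Bool) :
    ρ.Decided E h ∅ x := by
  obtain ⟨i, j, a, -, rfl⟩ := hE
  have hc : ({i, j} : Finset (Fin m)).card ≤ 2 := Finset.card_le_two
  refine .query h 0 ∅ {i, j} x (by omega) fun g => .leaf _ _ _
    (g ⟨i, by simp⟩ ≠ bin a ∨ g ⟨j, by simp⟩ ≠ bin a) fun z hz _ => ?_
  have hi := hz i (by simp)
  have hj := hz j (by simp)
  rw [dif_pos (by simp)] at hi hj
  rw [satDNF_clauseOf_avoidHole, hi, hj]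

/-- There is room to place both pigeons of the clause legally, hence in different holes, while
falsity of the clause puts both into the hole `a`. -/
theorem not_refutable_of_mem_binPHP (ρ : Restriction (Fin m) k s) {E : DNF (Fin m × Fin k)}
    (hE : E ∈ BinPHP m k) {h : ℕ} (hh : h + 2 ≤ 2 ^ (k - s)) : ¬ ρ.Refutable h E := by
  rintro ⟨P, x, hP, hPh, hF⟩
  obtain ⟨i, j, a, hij, rfl⟩ := hE
  have hc : ({i, j} : Finset (Fin m)).card ≤ 2 := Finset.card_le_two
  obtain ⟨y, hy, hyx⟩ := hP.extend {i, j} (by omega)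
  obtain ⟨z, hz, hza⟩ := hy.exists_total
  have hf := hF z (fun i hi => by rw [hz i (Finset.mem_union_left _ hi), hyx i hi]) fun i _ => hza i
  rw [satDNF_clauseOf_avoidHole, iff_false, not_or, not_not, not_not] at hf
  have hi : i ∈ P ∪ {i, j} := by simp
  have hj : j ∈ P ∪ {i, j} := by simp
  refine hij (hy.2 i hi j hj ?_)
  rw [← hz i hi, ← hz j hj, hf.1, hf.2]

/-- There is no refutation all of whose lines are decided by few queries. -/
theorem exists_not_decided {s' h : ℕ} (ρ : Restriction (Fin m) k s) (hh2 : 2 ≤ h)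
    (hh : 3 * h ≤ 2 ^ (k - s)) (π : ResRefutation s' (BinPHP m k)) (x : Fin m → Fin k → Bool) :
    ∃ i, ¬ ρ.Decided (π.line i) h ∅ x := by
  by_contra! hd
  have hax : ∀ E ∈ BinPHP m k, ¬ ρ.Refutable h E := fun E hE =>
    ρ.not_refutable_of_mem_binPHP hE (by omega)
  have hline : ∀ i, ¬ ρ.Refutable h (π.line i) := by
    intro i
    induction i using WellFoundedLT.induction with
    | _ i ih =>
      intro hi
      obtain ⟨D₁, h₁, D₂, h₂, hs⟩ := (π.derived i).sound
      have hdec : ∀ D ∈ BinPHP m k ∪ {D | ∃ j, j < i ∧ π.line j = D},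
          ρ.Decided D h ∅ x ∧ ¬ ρ.Refutable h D := by
        rintro D (hD | ⟨j, hj, rfl⟩)
        · exact ⟨ρ.decided_of_mem_binPHP hD hh2 x, hax D hD⟩
        · exact ⟨hd j, ih j hj⟩
      rcases hi.of_sound hh x (hdec _ h₁).1 (hdec _ h₂).1 hs with hr | hr
      · exact (hdec _ h₁).2 hr
      · exact (hdec _ h₂).2 hr
  have hempty : ρ.Refutable h (∅ : DNF (Fin m × Fin k)) :=
    ⟨∅, x, ⟨by simp, by simp⟩, by simp, fun z _ _ => by simp [SatDNF]⟩
  rcases π.refutes with h0 | ⟨i, hi⟩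
  · exact hax _ h0 hempty
  · exact hline i (hi ▸ hempty)

end Restriction

/-- The lower bound on the size of refutations, in terms of the parameters of the restriction. -/
theorem two_pow_le_size {m k s s' e : ℕ} (hk : 0 < k) (hs : s' ≤ s) (hs1 : 1 ≤ s) (he : 2 ≤ e)
    (h : 3 * (e * Restriction.growth k s ^ s) ≤ 2 ^ (k - s)) (π : ResRefutation s' (BinPHP m k)) :
    2 ^ e ≤ π.size := by
  classical
  by_contra! hlt
  have : Nonempty (Fin k) := ⟨⟨0, hk⟩⟩
  have hG : 2 ≤ Restriction.growth k s := by
    have : 0 < k * (s * (2 * k) ^ s) := by positivity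
    unfold Restriction.growth; omega
  have hG' : 2 ≤ Restriction.growth k s ^ s := hG.trans (Nat.le_self_pow (by omega) _)
  have hcard := π.card_le hs fun E hE T hT => (card_le_one_of_mem_binPHP hE T hT).trans hs1
  let x : Fin m → Fin k → Bool := fun _ _ => false
  have hp : unifProb (fun ρ : Restriction (Fin m) k s => ∃ i,
      ¬ ρ.Decided (π.line i) (e * Restriction.growth k s ^ s - e) ∅ x) < 1 := by
    refine (unifProb_exists_le _).trans_lt ?_
    have hle : ∀ i, unifProb (fun ρ : Restriction (Fin m) k s =>
        ¬ ρ.Decided (π.line i) (e * Restriction.growth k s ^ s - e) ∅ x) ≤ (1 / 2) ^ e := fun i =>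
      Restriction.unifProb_not_decided_le hk (π.line i) (hcard i) s e ∅ x fun T hT _ =>
        (Finset.card_filter_le _ _).trans (hcard i T hT)
    refine (Finset.sum_le_sum fun i _ => hle i).trans_lt ?_
    have h2 : (π.size : ℝ) < 2 ^ e := by exact_mod_cast hlt
    rw [Finset.sum_const, Finset.card_univ, Fintype.card_fin, nsmul_eq_mul, one_div, inv_pow,
      ← div_eq_mul_inv, div_lt_one (by positivity)]
    exact h2
  obtain ⟨ρ, hρ⟩ := exists_not_of_unifProb_lt_one hp
  push Not at hρ
  -- Hence the height `e * growth k s ^ s - e` is at least `e ≥ 2`, enough to query both pigeons of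
  -- an initial clause.
  have h1 : e * 2 ≤ e * Restriction.growth k s ^ s := Nat.mul_le_mul_left _ hG'
  obtain ⟨i, hi⟩ := ρ.exists_not_decided (h := e * Restriction.growth k s ^ s - e)
    (by omega) (by omega) π x
  exact hi (hρ i)

/-! ### Asymptotics of the parameters -/

theorem Restriction.growth_le {k s : ℕ} (hs : s ≤ k) (hk : 0 < k) : Restriction.growth k s ≤ (2 * k) ^ (s + 2) := by
  have h1 : 1 ≤ k * k * (2 * k) ^ s := Nat.one_le_iff_ne_zero.2 (by positivity)
  have h2 : k * (s * (2 * k) ^ s) ≤ k * (k * (2 * k) ^ s) := by gcongr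
  unfold Restriction.growth
  rw [pow_add]
  nlinarith

theorem Restriction.growth_pow_le {k s : ℕ} (hs1 : 1 ≤ s) (hs : s ≤ k) (hk : 3 ≤ k) :
    6 * Restriction.growth k s ^ s * 2 ^ s ≤ (2 * k) ^ (5 * s ^ 2) := by
  calc 6 * Restriction.growth k s ^ s * 2 ^ s
      ≤ (2 * k) ^ s * ((2 * k) ^ (s + 2)) ^ s * (2 * k) ^ s := by
        gcongr
        · exact (show 6 ≤ 2 * k by omega).trans (Nat.le_self_pow (by omega) _)
        · exact Restriction.growth_le hs (by omega)
        · omega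
    _ = (2 * k) ^ (s ^ 2 + 4 * s) := by
        rw [← pow_mul, ← pow_add, ← pow_add]
        congr 1
        ring
    _ ≤ (2 * k) ^ (5 * s ^ 2) := by
        refine Nat.pow_le_pow_right (by omega) ?_
        nlinarith

open Filter Asymptotics in
-- Since `log k = o(k ^ a)`, half of `b` bounds `log k`, and the other half absorbs `log 2 ≤ log k`.
theorem eventually_log_le_rpow {a b : ℝ} (ha : 0 < a) (hb : 0 < b) :
    ∀ᶠ k : ℕ in atTop, Real.logb 2 (2 * k) ≤ b * (k : ℝ) ^ a := by
  have h := (isLittleO_log_rpow_atTop ha).bound (show 0 < b / 2 * Real.log 2 by positivity)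
  filter_upwards [tendsto_natCast_atTop_atTop.eventually h, eventually_ge_atTop 2] with k hk hk2
  have hk2' : (2 : ℝ) ≤ k := by exact_mod_cast hk2
  have hlog : 0 < Real.log 2 := Real.log_pos (by norm_num)
  rw [Real.norm_of_nonneg (Real.log_nonneg (by linarith)),
    Real.norm_of_nonneg (by positivity)] at hk
  have h2 : Real.log 2 ≤ Real.log k := Real.log_le_log (by norm_num) hk2'
  rw [Real.logb, div_le_iff₀ hlog, Real.log_mul (by norm_num) (by linarith)]
  nlinarith

open Filter in
/-- The loss in the size lower bound is `n ^ o(1)`. -/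
theorem eventually_loss_le {lam mu : ℝ} (hlam : 0 < lam) (hlam' : lam ≤ 1 / 4) (hmu : 0 < mu) :
    ∀ᶠ k : ℕ in atTop, ∀ s : ℕ, 1 ≤ s → (s : ℝ) ≤ √2 * (k : ℝ) ^ ((1 : ℝ) / 2 - lam) →
      s ≤ k ∧ 6 * (Restriction.growth k s : ℝ) ^ s * 2 ^ s ≤ 2 ^ (mu * k) := by
  filter_upwards [eventually_log_le_rpow (a := 2 * lam) (b := mu / 10) (by linarith) (by linarith),
    eventually_ge_atTop 3] with k hk hk3 s hs1 hs
  have hk3' : (3 : ℝ) ≤ k := by exact_mod_cast hk3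
  have hk0 : (0 : ℝ) < k := by linarith
  have hsq : (s : ℝ) ^ 2 ≤ 2 * (k : ℝ) ^ (1 - 2 * lam) := by
    calc (s : ℝ) ^ 2 ≤ (√2 * (k : ℝ) ^ ((1 : ℝ) / 2 - lam)) ^ 2 := by gcongr
      _ = 2 * (k : ℝ) ^ (1 - 2 * lam) := by
        rw [mul_pow, Real.sq_sqrt (by norm_num), ← Real.rpow_natCast, ← Real.rpow_mul hk0.le]
        norm_num
        ring_nf
  have hsk : s ≤ k := by
    have h1 : (k : ℝ) ^ (1 - 2 * lam) ≤ k := by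
      simpa using Real.rpow_le_rpow_of_exponent_le (by linarith : (1 : ℝ) ≤ k)
        (by linarith : 1 - 2 * lam ≤ 1)
    have h2 : (s : ℝ) ≤ k := by nlinarith
    exact_mod_cast h2
  refine ⟨hsk, ?_⟩
  have h1 : (6 * (Restriction.growth k s : ℝ) ^ s * 2 ^ s) ≤ ((2 * k : ℝ)) ^ (5 * s ^ 2) := by
    exact_mod_cast Restriction.growth_pow_le hs1 hsk hk3
  refine h1.trans ?_
  have h2k : (0 : ℝ) < 2 * k := by positivity
  have hL0 : 0 ≤ Real.logb 2 (2 * k) := Real.logb_nonneg (by norm_num) (by linarith)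
  have h3 : ((2 * k : ℝ)) ^ (5 * s ^ 2) = 2 ^ (Real.logb 2 (2 * k) * (5 * s ^ 2)) := by
    rw [Real.rpow_mul (by norm_num), Real.rpow_logb (by norm_num) (by norm_num) h2k]
    exact_mod_cast rfl
  rw [h3]
  refine Real.rpow_le_rpow_of_exponent_le (by norm_num) ?_
  calc Real.logb 2 (2 * k) * (5 * s ^ 2)
      ≤ (mu / 10 * (k : ℝ) ^ (2 * lam)) * (5 * (2 * (k : ℝ) ^ (1 - 2 * lam))) := by gcongr
    _ = mu * ((k : ℝ) ^ (2 * lam) * (k : ℝ) ^ (1 - 2 * lam)) := by ring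
    _ = mu * k := by
      rw [← Real.rpow_add hk0]
      norm_num

theorem mainTheorem2 (lam mu : ℝ) (hlam : 0 < lam) (hmu : 0 < mu) :
    ∃ c : ℝ, 0 < c ∧ ∃ n₀ : ℕ, ∀ n k m s : ℕ, n₀ ≤ n → n = 2 ^ k → n < m →
      (s : ℝ) ≤ Real.sqrt 2 * (Real.logb 2 (n : ℝ)) ^ ((1 : ℝ) / 2 - lam) →
      ∀ π : ResRefutation s (BinPHP m k),
        (2 : ℝ) ^ (c * (n : ℝ) ^ (1 - mu)) ≤ (π.size : ℝ) := by
  -- The cap keeps the exponent `1 / 2 - lam'` positive, so that the bound on `s` also admits `max s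
  -- 1`; initial clauses have terms of size 1 even if `s = 0`.
  obtain ⟨lam', hl0, hl4, hll⟩ : ∃ lam' : ℝ, 0 < lam' ∧ lam' ≤ 1 / 4 ∧ lam' ≤ lam :=
    ⟨min lam (1 / 4), by positivity, min_le_right _ _, min_le_left _ _⟩
  -- The cap makes `N ^ (1 - mu')` exceed 1, so its ceiling `e` is at least 2 and at most twice the
  -- power.
  obtain ⟨mu', hm0, hm2, hmm⟩ : ∃ mu' : ℝ, 0 < mu' ∧ mu' ≤ 1 / 2 ∧ mu' ≤ mu :=
    ⟨min mu (1 / 2), by positivity, min_le_right _ _, min_le_left _ _⟩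
  obtain ⟨k₀, hk₀⟩ := Filter.eventually_atTop.1 (eventually_loss_le hl0 hl4 hm0)
  refine ⟨1, one_pos, 2 ^ (k₀ + 1), ?_⟩
  rintro n k m s hn rfl - hs π
  have hk : k₀ + 1 ≤ k := (Nat.pow_le_pow_iff_right (by norm_num)).1 hn
  have hk1 : (1 : ℝ) ≤ k := by exact_mod_cast (by omega : 1 ≤ k)
  rw [Nat.cast_pow, Nat.cast_ofNat, Real.logb_pow, Real.logb_self_eq_one (by norm_num),
    mul_one] at hs
  have hs1 : (1 : ℝ) ≤ √2 * (k : ℝ) ^ ((1 : ℝ) / 2 - lam') :=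
    one_le_mul_of_one_le_of_one_le (Real.one_le_sqrt.2 (by norm_num))
      (Real.one_le_rpow hk1 (by linarith))
  have hs' : ((max s 1 : ℕ) : ℝ) ≤ √2 * (k : ℝ) ^ ((1 : ℝ) / 2 - lam') := by
    rw [Nat.cast_max, Nat.cast_one]
    refine max_le (hs.trans ?_) hs1
    gcongr
  obtain ⟨hsk, hloss⟩ := hk₀ k (by omega) (max s 1) (le_max_right _ _) hs'
  generalize ht : max s 1 = t at hs' hsk hloss
  have hst : s ≤ t := by omega
  let N : ℝ := (2 : ℝ) ^ k
  have hN1 : 1 < N := one_lt_pow₀ (by norm_num) (by omega)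
  have hNe : 1 < N ^ (1 - mu') := Real.one_lt_rpow hN1 (by linarith)
  let e := ⌈N ^ (1 - mu')⌉₊
  have he : 2 ≤ e := Nat.lt_ceil.2 (by exact_mod_cast hNe)
  have hele : (e : ℝ) ≤ 2 * N ^ (1 - mu') := by
    have := Nat.ceil_lt_add_one (by linarith : 0 ≤ N ^ (1 - mu'))
    linarith
  have hbound : 3 * (e * Restriction.growth k t ^ t) ≤ 2 ^ (k - t) := by
    have h1 : (3 * (e * (Restriction.growth k t : ℝ) ^ t)) * 2 ^ t ≤ 2 ^ (k - t) * 2 ^ t := by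
      rw [← pow_add, Nat.sub_add_cancel hsk]
      calc (3 * (e * (Restriction.growth k t : ℝ) ^ t)) * 2 ^ t
          = e * (3 * (Restriction.growth k t : ℝ) ^ t * 2 ^ t) := by ring
        _ ≤ 2 * N ^ (1 - mu') * (3 * (Restriction.growth k t : ℝ) ^ t * 2 ^ t) := by gcongr
        _ = N ^ (1 - mu') * (6 * (Restriction.growth k t : ℝ) ^ t * 2 ^ t) := by ring
        _ ≤ N ^ (1 - mu') * 2 ^ (mu' * k) := by gcongr
        _ = N ^ (1 - mu') * N ^ mu' := by
          rw [mul_comm mu', Real.rpow_mul (by norm_num), Real.rpow_natCast]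
        _ = 2 ^ k := by
          rw [← Real.rpow_add (by linarith), sub_add_cancel, Real.rpow_one]
    have h2 := le_of_mul_le_mul_right h1 (by positivity)
    exact_mod_cast h2
  have hsize := two_pow_le_size (by omega) hst (by omega) he hbound π
  calc (2 : ℝ) ^ (1 * (((2 ^ k : ℕ) : ℝ)) ^ (1 - mu)) ≤ 2 ^ (e : ℝ) := by
        refine Real.rpow_le_rpow_of_exponent_le (by norm_num) ?_
        rw [one_mul, Nat.cast_pow, Nat.cast_ofNat]
        exact (Real.rpow_le_rpow_of_exponent_le hN1.le (by linarith)).trans (Nat.le_ceil _)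
    _ ≤ π.size := by
        rw [Real.rpow_natCast]
        exact_mod_cast hsize
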